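/- Let $k$ be a field, $A$ a finite-dimensional $k$-algebra, $Q$ a finite quiver without oriented cycles, and $I$ a two-sided ideal of the path algebra $kQ$ that is generated by monomial relations, i.e. by paths of length at least one (for instance, by paths of length at least two). Paths are composed from right to left. Put $\Lambda := A\otimes_k kQ/I$. For a vertex $v$ of $Q$, let $e_v$ be the path of length $0$ at $v$ and $P(v) := (kQ/I)e_v$ the corresponding left $kQ/I$-module; for a left $A$-module $G$, the tensor product $G\otimes_k P(v)$ is a left $\Lambda$-module via $(a\otimes b)(g\otimes x) = ag\otimes bx$. A module over a ring $R$ is indecomposable if it is non-zero and not the direct sum of two non-zero submodules. It is Gorenstein-projective if it is isomorphic to $\operatorname{Ker} d^0$ for some exact sequence $P^\bullet = \cdots\to P^{-1}\to P^0\xrightarrow{d^0}P^1\to\cdots$ of finitely generated projective left $R$-modules such that $\operatorname{Hom}_R(P^\bullet,R)$ is also exact. If $G$ is an indecomposable Gorenstein-projective left $A$-module, then for every vertex $v$ of $Q$ the $\Lambda$-module $G\otimes_k P(v)$ is indecomposable and Gorenstein-projective. -/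

import Mathlib

open scoped TensorProduct

universe u w

/-! ### Modules: indecomposability and Gorenstein-projectivity -/

/-- A module is indecomposable if it is non-zero and is not the direct sum of two non-zero
submodules. -/
def IsIndecomposableModule (R : Type*) [Ring R] (M : Type*) [AddCommGroup M] [Module R M] : Prop :=
  Nontrivial M ∧ ∀ N N' : Submodule R M, IsCompl N N' → N = ⊥ ∨ N' = ⊥

/-- A complete `R`-projective resolution: an exact sequence
`⋯ → X (-1) → X 0 → X 1 → ⋯` of finitely generated projective (left) `R`-modules, which stays
exact after applying `Hom_R(-, R)`. (A finitely generated projective `R`-module is isomorphic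
to a direct summand of some `R ^ n`, so it is enough to use modules in the universe of `R`.) -/
structure CompleteProjectiveResolution (R : Type u) [Ring R] where
  /-- the terms of the complex -/
  X : ℤ → Type u
  [addCommGroup : ∀ n, AddCommGroup (X n)]
  [module : ∀ n, Module R (X n)]
  /-- the differentials -/
  d : ∀ n, X n →ₗ[R] X (n + 1)
  finite : ∀ n, Module.Finite R (X n)
  projective : ∀ n, Module.Projective R (X n)
  exact : ∀ n, Function.Exact (d n) (d (n + 1))
  exact_dual : ∀ n, Function.Exact
    (fun f : X (n + 1 + 1) →ₗ[R] R => f ∘ₗ d (n + 1))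
    (fun f : X (n + 1) →ₗ[R] R => f ∘ₗ d n)

attribute [instance] CompleteProjectiveResolution.addCommGroup CompleteProjectiveResolution.module

/-- An `R`-module is Gorenstein-projective if it is isomorphic to `Ker d⁰` for some complete
`R`-projective resolution. -/
def IsGorensteinProjective (R : Type u) [Ring R] (M : Type w) [AddCommGroup M] [Module R M] :
    Prop :=
  ∃ P : CompleteProjectiveResolution R, Nonempty (M ≃ₗ[R] LinearMap.ker (P.d 0))

/-! ### The path algebra of a finite quiver -/

/-- A path of the quiver `V`, together with its starting and its ending vertex. -/
structure QuiverPath (V : Type*) [Quiver V] where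
  /-- the starting vertex -/
  start : V
  /-- the ending vertex -/
  finish : V
  /-- the path itself -/
  path : Quiver.Path start finish

/-- The length (number of arrows) of a path. -/
def QuiverPath.length {V : Type*} [Quiver V] (p : QuiverPath V) : ℕ := p.path.length

/-- The path of length zero at the vertex `v`. -/
def QuiverPath.nil {V : Type*} [Quiver V] (v : V) : QuiverPath V := ⟨v, v, Quiver.Path.nil⟩

/-- The underlying vector space of the path algebra `kQ`: it has the paths as a basis. -/
def PathAlgebra (k : Type*) [Field k] (V : Type*) [Quiver V] : Type _ := QuiverPath V →₀ k

namespace PathAlgebra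

section

variable (k : Type*) [Field k] {V : Type*} [Quiver V]

noncomputable instance : AddCommGroup (PathAlgebra k V) :=
  inferInstanceAs (AddCommGroup (QuiverPath V →₀ k))

noncomputable instance : Module k (PathAlgebra k V) :=
  inferInstanceAs (Module k (QuiverPath V →₀ k))

/-- A path, as an element of the path algebra. -/
noncomputable def ofPath (p : QuiverPath V) : PathAlgebra k V := Finsupp.single p (1 : k)

/-- The paths form a basis of the path algebra. -/
noncomputable def pathBasis : Module.Basis (QuiverPath V) k (PathAlgebra k V) :=
  Module.Basis.ofRepr (LinearEquiv.refl k (QuiverPath V →₀ k))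

theorem pathBasis_apply (p : QuiverPath V) : pathBasis k p = ofPath k p := rfl

open Classical in
/-- The product `p q` of two paths: first `q`, then `p` if `q` ends where `p` starts, and zero
otherwise. -/
noncomputable def pathMul (p q : QuiverPath V) : PathAlgebra k V :=
  if h : q.finish = p.start then
    ofPath k ⟨q.start, p.finish, q.path.comp (p.path.cast h.symm rfl)⟩
  else 0

/-- The multiplication of the path algebra: the bilinear extension of the product of paths. -/
noncomputable def mulHom : PathAlgebra k V →ₗ[k] PathAlgebra k V →ₗ[k] PathAlgebra k V :=
  (pathBasis k).constr k fun p => (pathBasis k).constr k fun q => pathMul k p q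

noncomputable instance : Mul (PathAlgebra k V) := ⟨fun a b => mulHom k a b⟩

theorem mul_def (a b : PathAlgebra k V) : a * b = mulHom k a b := rfl

theorem ofPath_mul_ofPath (p q : QuiverPath V) : ofPath k p * ofPath k q = pathMul k p q := by
  rw [mul_def, ← pathBasis_apply, ← pathBasis_apply, mulHom, Module.Basis.constr_basis,
    Module.Basis.constr_basis]

theorem ofPath_mul_ofPath_comp {a b c : V} (p : Quiver.Path b c) (q : Quiver.Path a b) :
    ofPath k ⟨b, c, p⟩ * ofPath k ⟨a, b, q⟩ = ofPath k ⟨a, c, q.comp p⟩ := by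
  rw [ofPath_mul_ofPath, pathMul, dif_pos rfl]
  rfl

theorem ofPath_mul_ofPath_of_ne {p q : QuiverPath V} (h : q.finish ≠ p.start) :
    ofPath k p * ofPath k q = 0 := by
  rw [ofPath_mul_ofPath, pathMul, dif_neg h]

theorem induction_on {P : PathAlgebra k V → Prop} (a : PathAlgebra k V) (zero : P 0)
    (add : ∀ a b, P a → P b → P (a + b)) (smul : ∀ (r : k) (a), P a → P (r • a))
    (path : ∀ p, P (ofPath k p)) : P a := by
  refine Finsupp.induction_linear a zero add fun p r => ?_
  have h : (Finsupp.single p r : QuiverPath V →₀ k) = r • Finsupp.single p (1 : k) := by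
    rw [Finsupp.smul_single, smul_eq_mul, mul_one]
  rw [h]
  exact smul r _ (path p)

noncomputable instance : NonUnitalNonAssocRing (PathAlgebra k V) where
  left_distrib a b c := by simp only [mul_def, map_add]
  right_distrib a b c := by simp only [mul_def, map_add, LinearMap.add_apply]
  zero_mul a := by simp only [mul_def, map_zero, LinearMap.zero_apply]
  mul_zero a := by simp only [mul_def, map_zero]

theorem smul_mul_aux (r : k) (a b : PathAlgebra k V) : r • a * b = r • (a * b) := by
  simp only [mul_def, map_smul, LinearMap.smul_apply]

theorem mul_smul_aux (r : k) (a b : PathAlgebra k V) : a * r • b = r • (a * b) := by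
  simp only [mul_def, map_smul]

theorem mul_assoc_aux (a b c : PathAlgebra k V) : a * b * c = a * (b * c) := by
  induction a using induction_on with
  | zero => simp only [zero_mul]
  | add a a' h h' => simp only [add_mul, h, h']
  | smul r a h => simp only [smul_mul_aux, h]
  | path p =>
    induction b using induction_on with
    | zero => simp only [zero_mul, mul_zero]
    | add a a' h h' => simp only [add_mul, mul_add, h, h']
    | smul r a h => simp only [smul_mul_aux, mul_smul_aux, h]
    | path q =>
      induction c using induction_on with
      | zero => simp only [mul_zero]
      | add a a' h h' => simp only [mul_add, h, h']
      | smul r a h => simp only [mul_smul_aux, h]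
      | path s =>
        obtain ⟨p₁, p₂, p⟩ := p
        obtain ⟨q₁, q₂, q⟩ := q
        obtain ⟨s₁, s₂, s⟩ := s
        by_cases h : q₂ = p₁
        · subst h
          by_cases h' : s₂ = q₁
          · subst h'
            simp only [ofPath_mul_ofPath_comp, Quiver.Path.comp_assoc]
          · rw [ofPath_mul_ofPath_comp, ofPath_mul_ofPath_of_ne k (p := ⟨q₁, q₂, q⟩) h',
              ofPath_mul_ofPath_of_ne k (p := ⟨q₁, p₂, q.comp p⟩) h', mul_zero]
        · rw [ofPath_mul_ofPath_of_ne k (p := ⟨p₁, p₂, p⟩) h, zero_mul]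
          by_cases h' : s₂ = q₁
          · subst h'
            rw [ofPath_mul_ofPath_comp, ofPath_mul_ofPath_of_ne k (p := ⟨p₁, p₂, p⟩) h]
          · rw [ofPath_mul_ofPath_of_ne k (p := ⟨q₁, q₂, q⟩) h', mul_zero]

end

section

variable (k : Type*) [Field k] {V : Type*} [Quiver V]

/-- The element `e_v` of the path algebra given by the path of length zero at `v`. -/
noncomputable def vertex (v : V) : PathAlgebra k V := ofPath k (QuiverPath.nil v)

variable [Fintype V]

/-- The unit of the path algebra is the sum of all `e_v`. -/
noncomputable instance : One (PathAlgebra k V) := ⟨∑ v : V, vertex k v⟩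

theorem one_def : (1 : PathAlgebra k V) = ∑ v : V, vertex k v := rfl

theorem one_mul_aux (a : PathAlgebra k V) : 1 * a = a := by
  induction a using induction_on with
  | zero => rw [mul_zero]
  | add a a' h h' => rw [mul_add, h, h']
  | smul r a h => rw [mul_smul_aux, h]
  | path p =>
    rw [one_def, Finset.sum_mul, Finset.sum_eq_single p.finish]
    · exact ofPath_mul_ofPath_comp k Quiver.Path.nil p.path
    · intro v _ hv
      exact ofPath_mul_ofPath_of_ne k hv.symm
    · exact fun h => absurd (Finset.mem_univ _) h

theorem mul_one_aux (a : PathAlgebra k V) : a * 1 = a := by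
  induction a using induction_on with
  | zero => rw [zero_mul]
  | add a a' h h' => rw [add_mul, h, h']
  | smul r a h => rw [smul_mul_aux, h]
  | path p =>
    rw [one_def, Finset.mul_sum, Finset.sum_eq_single p.start]
    · refine (ofPath_mul_ofPath_comp k p.path Quiver.Path.nil).trans ?_
      rw [Quiver.Path.nil_comp]
    · intro v _ hv
      exact ofPath_mul_ofPath_of_ne k hv
    · exact fun h => absurd (Finset.mem_univ _) h

noncomputable instance : Ring (PathAlgebra k V) where
  __ := (inferInstance : NonUnitalNonAssocRing (PathAlgebra k V))
  mul_assoc := mul_assoc_aux k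
  one_mul := one_mul_aux k
  mul_one := mul_one_aux k

noncomputable instance : Algebra k (PathAlgebra k V) :=
  Algebra.ofModule (smul_mul_aux k) (mul_smul_aux k)

end

end PathAlgebra

/-! ### Monomial ideals and the bound quiver algebra -/

/-- A two-sided ideal `I` of `kQ` is monomial if it is generated by monomial relations, that is,
by a set of paths of length at least one. -/
def IsMonomialIdeal {k : Type*} [Field k] {V : Type*} [Quiver V] [Fintype V]
    (I : TwoSidedIdeal (PathAlgebra k V)) : Prop :=
  ∃ ρ : Set (QuiverPath V), (∀ p ∈ ρ, 1 ≤ p.length) ∧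
    I = TwoSidedIdeal.span (PathAlgebra.ofPath k '' ρ)

/-- The algebra `kQ/I`. -/
abbrev BoundQuiverAlgebra {k : Type*} [Field k] {V : Type*} [Quiver V] [Fintype V]
    (I : TwoSidedIdeal (PathAlgebra k V)) : Type _ :=
  PathAlgebra k V ⧸ I.asIdeal

/-- The left `kQ/I`-module `P(v) = (kQ/I) e_v`, as a left ideal of `kQ/I`. -/
noncomputable abbrev vertexProjective {k : Type*} [Field k] {V : Type*} [Quiver V] [Fintype V]
    (I : TwoSidedIdeal (PathAlgebra k V)) (v : V) :
    Submodule (BoundQuiverAlgebra I) (BoundQuiverAlgebra I) :=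
  Submodule.span (BoundQuiverAlgebra I) {Ideal.Quotient.mk I.asIdeal (PathAlgebra.vertex k v)}

/-! ### The external tensor product of modules -/

section

variable {k : Type*} [Field k] {A B M N : Type*} [Ring A] [Algebra k A] [Ring B] [Algebra k B]
  [AddCommGroup M] [Module A M] [Module k M] [IsScalarTower k A M]
  [AddCommGroup N] [Module B N] [Module k N] [IsScalarTower k B N]

variable (k A B M N) in
/-- The ring homomorphism `A ⊗ B → End_k (M ⊗ N)` sending `a ⊗ b` to `(a • ·) ⊗ (b • ·)`. -/
noncomputable def externalTensorAction : A ⊗[k] B →ₐ[k] Module.End k (M ⊗[k] N) :=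
  (Module.endTensorEndAlgHom (R := k) (S := k) (A := k) (M := M) (N := N)).comp
    (Algebra.TensorProduct.map (Algebra.lsmul k k M : A →ₐ[k] Module.End k M)
      (Algebra.lsmul k k N : B →ₐ[k] Module.End k N))

/-- For an `A`-module `M` and a `B`-module `N`, the `A ⊗ B`-module structure on `M ⊗ N`. -/
noncomputable instance (priority := 100) externalTensorModule : Module (A ⊗[k] B) (M ⊗[k] N) :=
  Module.compHom (M ⊗[k] N) (externalTensorAction k A B M N).toRingHom

theorem externalTensor_smul_tmul (a : A) (b : B) (m : M) (n : N) :
    (a ⊗ₜ[k] b) • (m ⊗ₜ[k] n) = (a • m) ⊗ₜ[k] (b • n) := rfl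

end

/-! ### External tensor products with the left ideal generated by an idempotent -/

/-! Write `B` for `kQ/I` and `e` for the class of `e_v`, so that `P(v) = B e`. Nothing about the
quiver is needed beyond three facts: `e` is idempotent, `e ≠ 0`, and `e B e = k e`. The first gives
Gorenstein-projectivity, all three together indecomposability, for any `k`-algebra `B`.

Gorenstein-projectivity: tensor a complete resolution over `k` with `B e`. Exactness survives
because `k` is a field. The rest follows from the correspondence between `A ⊗ B`-linear maps `M ⊗ B
e → Y` and `A`-linear maps `M → (1 ⊗ e) Y`, given by evaluation at `m ⊗ e`
(`externalTensorRestrict`, `externalTensorLift`). It reduces lifting problems over `A ⊗ B` to ones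
over `A`, and exactness of the dual complex to exactness of `Hom_A(-, A ⊗ B)`, where `A ⊗ B` is free
over `A`.

Indecomposability: `(1 ⊗ e)(G ⊗ B e) = G ⊗ e B e` is a copy of `G`, so a decomposition of `G ⊗ B e`
cuts out one of `G`. A summand containing this whole copy is everything, since the `m ⊗ e` generate.
-/

section ExternalTensor

variable {k A B : Type*} [Field k] [Ring A] [Algebra k A] [Ring B] [Algebra k B]

section Map

variable {M M' N : Type*} [AddCommGroup M] [Module A M] [Module k M] [IsScalarTower k A M]
  [AddCommGroup M'] [Module A M'] [Module k M'] [IsScalarTower k A M']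
  [AddCommGroup N] [Module B N] [Module k N] [IsScalarTower k B N]

variable (B N) in
/-- The `A ⊗ B`-linear map `f ⊗ N` induced by an `A`-linear map `f`. -/
noncomputable def externalRTensor (f : M →ₗ[A] M') : M ⊗[k] N →ₗ[A ⊗[k] B] M' ⊗[k] N where
  __ := (f.restrictScalars k).rTensor N
  map_smul' c t := by
    change (f.restrictScalars k).rTensor N (c • t) = c • (f.restrictScalars k).rTensor N t
    induction c with
    | zero => simp only [zero_smul, map_zero]
    | add c c' h h' => simp only [add_smul, map_add, h, h']
    | tmul a b =>
      induction t with
      | zero => simp only [smul_zero, map_zero]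
      | add t t' h h' => simp only [smul_add, map_add, h, h']
      | tmul m n =>
        simp only [externalTensor_smul_tmul, LinearMap.rTensor_tmul,
          LinearMap.restrictScalars_apply, map_smul]

theorem externalRTensor_tmul (f : M →ₗ[A] M') (m : M) (n : N) :
    externalRTensor (k := k) B N f (m ⊗ₜ n) = f m ⊗ₜ n := rfl

theorem externalRTensor_injective {f : M →ₗ[A] M'} (hf : Function.Injective f) :
    Function.Injective (externalRTensor (k := k) B N f) :=
  Module.Flat.rTensor_preserves_injective_linearMap (f.restrictScalars k) hf

theorem externalRTensor_exact {M'' : Type*} [AddCommGroup M''] [Module A M''] [Module k M'']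
    [IsScalarTower k A M''] {f : M →ₗ[A] M'} {g : M' →ₗ[A] M''} (h : Function.Exact f g) :
    Function.Exact (externalRTensor (k := k) B N f) (externalRTensor (k := k) B N g) :=
  Module.Flat.rTensor_exact (M := N) (f := f.restrictScalars k) (g := g.restrictScalars k) h

end Map

/-! ### Maps out of `M ⊗ B e` -/

variable {M : Type*} [AddCommGroup M] [Module A M] [Module k M] [IsScalarTower k A M]

/-- The generator `e` of the left ideal `B e`. -/
def spanGenerator (e : B) : Submodule.span B {e} := ⟨e, Submodule.mem_span_singleton_self e⟩

theorem smul_spanGenerator {e : B} (he : IsIdempotentElem e) (n : Submodule.span B {e}) :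
    (n : B) • spanGenerator e = n := by
  obtain ⟨n, hn⟩ := n
  obtain ⟨b, rfl⟩ := Submodule.mem_span_singleton.1 hn
  refine Subtype.ext ?_
  change (b * e) * e = b * e
  rw [mul_assoc, he]

theorem tmul_eq_smul_tmul_spanGenerator {e : B} (he : IsIdempotentElem e) (m : M)
    (n : Submodule.span B {e}) :
    m ⊗ₜ[k] n = ((1 : A) ⊗ₜ[k] (n : B)) • (m ⊗ₜ[k] spanGenerator e) := by
  rw [externalTensor_smul_tmul, one_smul, smul_spanGenerator he]

/-- `A ⊗ B`-linear maps on `M ⊗ B e` are determined by their values on the `m ⊗ e`. -/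
theorem externalTensor_hom_ext {e : B} (he : IsIdempotentElem e) {Y : Type*} [AddCommGroup Y]
    [Module (A ⊗[k] B) Y] {f g : M ⊗[k] Submodule.span B {e} →ₗ[A ⊗[k] B] Y}
    (h : ∀ m, f (m ⊗ₜ spanGenerator e) = g (m ⊗ₜ spanGenerator e)) : f = g := by
  ext t
  induction t with
  | zero => simp only [map_zero]
  | add t t' h h' => simp only [map_add, h, h']
  | tmul m n => rw [tmul_eq_smul_tmul_spanGenerator (A := A) he, map_smul, map_smul, h]

theorem externalTensor_eq_top {e : B} (he : IsIdempotentElem e)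
    {S : Submodule (A ⊗[k] B) (M ⊗[k] Submodule.span B {e})}
    (h : ∀ m : M, m ⊗ₜ[k] spanGenerator e ∈ S) : S = ⊤ := by
  refine eq_top_iff.2 fun t _ => ?_
  induction t with
  | zero => exact zero_mem _
  | add t t' h h' => exact add_mem (h trivial) (h' trivial)
  | tmul m n =>
    rw [tmul_eq_smul_tmul_spanGenerator (A := A) he]
    exact S.smul_mem _ (h m)

section Lift

variable {Y : Type*} [AddCommGroup Y] [Module (A ⊗[k] B) Y]

/-- The additive map `M ⊗ B e → Y`, `m ⊗ n ↦ n ψ(m)` underlying `externalTensorLift`. -/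
noncomputable def externalTensorLiftAux (e : B)
    (ψ : M →ₛₗ[(Algebra.TensorProduct.includeLeftRingHom : A →+* A ⊗[k] B)] Y) :
    M ⊗[k] Submodule.span B {e} →+ Y :=
  TensorProduct.liftAddHom
    { toFun := fun m =>
        { toFun := fun n => ((1 : A) ⊗ₜ[k] (n : B)) • ψ m
          map_zero' := by
            rw [Submodule.coe_zero, TensorProduct.tmul_zero, zero_smul]
          map_add' := fun n n' => by
            rw [Submodule.coe_add, TensorProduct.tmul_add, add_smul] }
      map_zero' := by
        ext n
        change ((1 : A) ⊗ₜ[k] (n : B)) • ψ 0 = 0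
        rw [map_zero, smul_zero]
      map_add' := fun m m' => by
        ext n
        change ((1 : A) ⊗ₜ[k] (n : B)) • ψ (m + m') =
          ((1 : A) ⊗ₜ[k] (n : B)) • ψ m + ((1 : A) ⊗ₜ[k] (n : B)) • ψ m'
        rw [map_add, smul_add] }
    fun r m n => by
      change ((1 : A) ⊗ₜ[k] (n : B)) • ψ (r • m) = ((1 : A) ⊗ₜ[k] (r • (n : B))) • ψ m
      rw [← algebraMap_smul A r m, map_smulₛₗ, smul_smul]
      congr 1
      change ((1 : A) ⊗ₜ[k] (n : B)) * (algebraMap k A r ⊗ₜ[k] 1) = _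
      rw [Algebra.TensorProduct.tmul_mul_tmul, one_mul, mul_one, Algebra.algebraMap_eq_smul_one,
        TensorProduct.smul_tmul]

theorem externalTensorLiftAux_tmul (e : B)
    (ψ : M →ₛₗ[(Algebra.TensorProduct.includeLeftRingHom : A →+* A ⊗[k] B)] Y)
    (m : M) (n : Submodule.span B {e}) :
    externalTensorLiftAux e ψ (m ⊗ₜ n) = ((1 : A) ⊗ₜ[k] (n : B)) • ψ m := rfl

/-- The `A ⊗ B`-linear map `M ⊗ B e → Y`, `m ⊗ n ↦ n ψ(m)`, for an `A`-linear map `ψ : M → Y`. -/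
noncomputable def externalTensorLift (e : B)
    (ψ : M →ₛₗ[(Algebra.TensorProduct.includeLeftRingHom : A →+* A ⊗[k] B)] Y) :
    M ⊗[k] Submodule.span B {e} →ₗ[A ⊗[k] B] Y where
  __ := externalTensorLiftAux e ψ
  map_smul' c t := by
    change externalTensorLiftAux e ψ (c • t) = c • externalTensorLiftAux e ψ t
    induction c with
    | zero => simp only [zero_smul, map_zero]
    | add c c' h h' => simp only [add_smul, map_add, h, h']
    | tmul a b =>
      induction t with
      | zero => simp only [smul_zero, map_zero]
      | add t t' h h' => simp only [smul_add, map_add, h, h']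
      | tmul m n =>
        rw [externalTensor_smul_tmul, externalTensorLiftAux_tmul, externalTensorLiftAux_tmul,
          map_smulₛₗ, smul_smul, smul_smul]
        congr 1
        change ((1 : A) ⊗ₜ[k] (b * (n : B))) * (a ⊗ₜ[k] 1) = _
        rw [Algebra.TensorProduct.tmul_mul_tmul, Algebra.TensorProduct.tmul_mul_tmul, one_mul,
          mul_one, mul_one]

/-- The values of `ψ` need not lie in `(1 ⊗ e) Y`: the lift projects them there, so it recovers `ψ`
only up to the factor `1 ⊗ e`. -/
theorem externalTensorLift_tmul_spanGenerator (e : B)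
    (ψ : M →ₛₗ[(Algebra.TensorProduct.includeLeftRingHom : A →+* A ⊗[k] B)] Y) (m : M) :
    externalTensorLift e ψ (m ⊗ₜ spanGenerator e) = ((1 : A) ⊗ₜ[k] e) • ψ m := rfl

theorem one_tmul_smul_tmul_spanGenerator {e : B} (he : IsIdempotentElem e) (m : M) :
    ((1 : A) ⊗ₜ[k] e) • (m ⊗ₜ[k] spanGenerator e) = m ⊗ₜ[k] spanGenerator e :=
  (tmul_eq_smul_tmul_spanGenerator he m (spanGenerator e)).symm

/-- The `A`-linear map `m ↦ f (m ⊗ e)`. -/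
noncomputable def externalTensorRestrict {e : B}
    (f : M ⊗[k] Submodule.span B {e} →ₗ[A ⊗[k] B] Y) :
    M →ₛₗ[(Algebra.TensorProduct.includeLeftRingHom : A →+* A ⊗[k] B)] Y where
  toFun m := f (m ⊗ₜ spanGenerator e)
  map_add' m m' := by rw [TensorProduct.add_tmul, map_add]
  map_smul' a m := by
    rw [← map_smul]
    change _ = f ((a ⊗ₜ[k] (1 : B)) • _)
    rw [externalTensor_smul_tmul, one_smul]

end Lift

/-! ### Projectivity and exactness of the dual complex -/

theorem externalTensor_finite [Module.Finite A M] {e : B} (he : IsIdempotentElem e) :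
    Module.Finite (A ⊗[k] B) (M ⊗[k] Submodule.span B {e}) := by
  classical
  obtain ⟨s, hs⟩ := Module.Finite.fg_top (R := A) (M := M)
  refine ⟨⟨s.image fun m => m ⊗ₜ[k] spanGenerator e, externalTensor_eq_top he fun m => ?_⟩⟩
  have hm : m ∈ Submodule.span A (s : Set M) := hs ▸ Submodule.mem_top
  induction hm using Submodule.span_induction with
  | mem m hm => exact Submodule.subset_span (by exact_mod_cast Finset.mem_image_of_mem _ hm)
  | zero => rw [TensorProduct.zero_tmul]; exact zero_mem _
  | add m m' _ _ h h' => rw [TensorProduct.add_tmul]; exact add_mem h h'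
  | smul a m _ h =>
    have := Submodule.smul_mem _ (a ⊗ₜ[k] (1 : B)) h
    rwa [externalTensor_smul_tmul, one_smul] at this

/-- To split a surjection `f` onto `M ⊗ B e`, lift `m ↦ m ⊗ e` through `f` over `A`, then extend to
`M ⊗ B e`. The factor `1 ⊗ e` introduced by the extension is harmless because it fixes `m ⊗ e`. -/
theorem externalTensor_projective [Module.Projective A M] {e : B} (he : IsIdempotentElem e) :
    Module.Projective (A ⊗[k] B) (M ⊗[k] Submodule.span B {e}) := by
  refine .of_lifting_property'' fun f hf => ?_
  let ι : A →+* A ⊗[k] B := Algebra.TensorProduct.includeLeftRingHom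
  let _ : Module A (M ⊗[k] Submodule.span B {e} →₀ A ⊗[k] B) :=
    Module.compHom _ ι
  let _ : Module A (M ⊗[k] Submodule.span B {e}) := Module.compHom _ ι
  let f' : (M ⊗[k] Submodule.span B {e} →₀ A ⊗[k] B) →ₗ[A] M ⊗[k] Submodule.span B {e} :=
    { toFun := f
      map_add' := f.map_add
      map_smul' := fun a y => f.map_smul (ι a) y }
  let j : M →ₗ[A] M ⊗[k] Submodule.span B {e} :=
    { toFun := externalTensorRestrict LinearMap.id
      map_add' := map_add _
      map_smul' := fun a m => (externalTensorRestrict LinearMap.id).map_smulₛₗ a m }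
  obtain ⟨h, hh⟩ := Module.projective_lifting_property f' j hf
  let ψ : M →ₛₗ[ι] (M ⊗[k] Submodule.span B {e} →₀ A ⊗[k] B) :=
    { toFun := h
      map_add' := h.map_add
      map_smul' := h.map_smul }
  refine ⟨externalTensorLift e ψ, externalTensor_hom_ext he fun m => ?_⟩
  have hm : f (ψ m) = m ⊗ₜ spanGenerator e := LinearMap.congr_fun hh m
  rw [LinearMap.comp_apply, externalTensorLift_tmul_spanGenerator, map_smul, hm,
    one_tmul_smul_tmul_spanGenerator he, LinearMap.id_apply]

/-- If `Hom(-, A)` is exact at `f, g`, then so is `Hom(-, F)` for every free module `F`. -/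
theorem exists_comp_eq_of_exact_dual {R X₀ X₁ X₂ F ι : Type*} [Ring R]
    [AddCommGroup X₀] [Module R X₀] [AddCommGroup X₁] [Module R X₁] [Module.Finite R X₁]
    [AddCommGroup X₂] [Module R X₂] [AddCommGroup F] [Module R F] (b : Module.Basis ι R F)
    {f : X₀ →ₗ[R] X₁} {g : X₁ →ₗ[R] X₂}
    (h : Function.Exact (fun φ : X₂ →ₗ[R] R => φ ∘ₗ g) (fun φ : X₁ →ₗ[R] R => φ ∘ₗ f))
    (φ : X₁ →ₗ[R] F) (hφ : φ ∘ₗ f = 0) : ∃ ψ : X₂ →ₗ[R] F, ψ ∘ₗ g = φ := by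
  classical
  have key (i : ι) : ∃ ψ : X₂ →ₗ[R] R, ψ ∘ₗ g = b.coord i ∘ₗ φ :=
    (h _).1 (by
      change (b.coord i ∘ₗ φ) ∘ₗ f = 0
      rw [LinearMap.comp_assoc, hφ, LinearMap.comp_zero])
  choose ψ hψ using key
  obtain ⟨s, hs⟩ := Module.Finite.fg_top (R := R) (M := X₁)
  -- The basis may be infinite, but only finitely many coordinates of `φ` are non-zero on the
  -- generators of `X₁`, so a finite sum of the coordinatewise extensions suffices.
  let S : Finset ι := s.biUnion fun x => (b.repr (φ x)).support
  refine ⟨∑ i ∈ S, (ψ i).smulRight (b i), ?_⟩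
  refine LinearMap.ext_on hs fun x hx => ?_
  have hi (i : ι) : ψ i (g x) = b.repr (φ x) i := LinearMap.congr_fun (hψ i) x
  rw [LinearMap.comp_apply, LinearMap.sum_apply]
  simp only [LinearMap.smulRight_apply, hi]
  conv_rhs => rw [← b.linearCombination_repr (φ x), Finsupp.linearCombination_apply]
  refine (Finsupp.sum_of_support_subset _ (Finset.subset_biUnion_of_mem
    (fun x => (b.repr (φ x)).support) hx) (fun i r => r • b i) fun i _ => zero_smul _ _).symm

/-- A map `φ` killed by `f ⊗ B e` restricts to an `A`-linear map `M₁ → A ⊗ B` killed by `f`. A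
`k`-basis of `B` is an `A`-basis of `A ⊗ B`, so this map factors through `g`, and the factor extends
to `M₂ ⊗ B e`. -/
theorem externalTensor_exact_dual {M₀ M₁ M₂ : Type*} [AddCommGroup M₀] [Module A M₀] [Module k M₀]
    [IsScalarTower k A M₀] [AddCommGroup M₁] [Module A M₁] [Module k M₁] [IsScalarTower k A M₁]
    [AddCommGroup M₂] [Module A M₂] [Module k M₂] [IsScalarTower k A M₂] [Module.Finite A M₁]
    {e : B} (he : IsIdempotentElem e) {f : M₀ →ₗ[A] M₁} {g : M₁ →ₗ[A] M₂} (hgf : g ∘ₗ f = 0)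
    (h : Function.Exact (fun φ : M₂ →ₗ[A] A => φ ∘ₗ g) (fun φ : M₁ →ₗ[A] A => φ ∘ₗ f)) :
    Function.Exact
      (fun φ : M₂ ⊗[k] Submodule.span B {e} →ₗ[A ⊗[k] B] A ⊗[k] B =>
        φ ∘ₗ externalRTensor B (Submodule.span B {e}) g)
      (fun φ : M₁ ⊗[k] Submodule.span B {e} →ₗ[A ⊗[k] B] A ⊗[k] B =>
        φ ∘ₗ externalRTensor B (Submodule.span B {e}) f) := by
  have smul_def (a : A) (t : A ⊗[k] B) : a • t = (a ⊗ₜ[k] (1 : B)) • t := by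
    rw [smul_eq_mul]
    induction t with
    | zero => rw [smul_zero, mul_zero]
    | add t t' h h' => rw [smul_add, mul_add, h, h']
    | tmul c b =>
      rw [TensorProduct.smul_tmul', Algebra.TensorProduct.tmul_mul_tmul, one_mul, smul_eq_mul]
  intro φ
  constructor
  · intro hφ
    let φ' : M₁ →ₗ[A] A ⊗[k] B :=
      { toFun := externalTensorRestrict φ
        map_add' := map_add _
        map_smul' := fun a m => by
          rw [map_smulₛₗ, RingHom.id_apply, smul_def]
          rfl }
    have hφ' : φ' ∘ₗ f = 0 := by
      ext m
      exact LinearMap.congr_fun hφ (m ⊗ₜ spanGenerator e)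
    obtain ⟨ψ, hψ⟩ := exists_comp_eq_of_exact_dual
      (Algebra.TensorProduct.basis A (Module.Basis.ofVectorSpace k B)) h φ' hφ'
    let ψ' : M₂ →ₛₗ[(Algebra.TensorProduct.includeLeftRingHom : A →+* A ⊗[k] B)] A ⊗[k] B :=
      { toFun := ψ
        map_add' := ψ.map_add
        map_smul' := fun a m => by rw [map_smul, smul_def]; rfl }
    refine ⟨externalTensorLift e ψ', externalTensor_hom_ext he fun m => ?_⟩
    rw [LinearMap.comp_apply, externalRTensor_tmul, externalTensorLift_tmul_spanGenerator]
    have hm : ψ' (g m) = φ (m ⊗ₜ spanGenerator e) := LinearMap.congr_fun hψ m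
    rw [hm, ← map_smul, one_tmul_smul_tmul_spanGenerator he]
  · rintro ⟨φ, rfl⟩
    refine externalTensor_hom_ext he fun m => ?_
    have hm : g (f m) = 0 := LinearMap.congr_fun hgf m
    simp only [LinearMap.comp_apply, externalRTensor_tmul, hm, TensorProduct.zero_tmul, map_zero,
      LinearMap.zero_apply]

end ExternalTensor

/-- For an idempotent `e` of `B`, tensoring with `B e` preserves Gorenstein-projectivity. -/
theorem IsGorensteinProjective.externalTensor {k A B : Type*} [Field k] [Ring A] [Algebra k A]
    [Ring B] [Algebra k B] {G : Type*} [AddCommGroup G] [Module A G] [Module k G]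
    [IsScalarTower k A G] (hG : IsGorensteinProjective A G) {e : B} (he : IsIdempotentElem e) :
    IsGorensteinProjective (A ⊗[k] B) (G ⊗[k] Submodule.span B {e}) := by
  obtain ⟨P, ⟨i⟩⟩ := hG
  -- The terms of the resolution are only `A`-modules; forming `⊗[k]` requires restricting scalars
  -- to `k`.
  let _ : ∀ n, Module k (P.X n) := fun n => Module.compHom (P.X n) (algebraMap k A)
  have : ∀ n, IsScalarTower k A (P.X n) := fun n => IsScalarTower.of_compHom k A (P.X n)
  have := P.finite
  have := P.projective
  let C : CompleteProjectiveResolution (A ⊗[k] B) :=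
    { X := fun n => P.X n ⊗[k] Submodule.span B {e}
      d := fun n => externalRTensor B (Submodule.span B {e}) (P.d n)
      finite := fun n => externalTensor_finite he
      projective := fun n => externalTensor_projective he
      exact := fun n => externalRTensor_exact (P.exact n)
      exact_dual := fun n => externalTensor_exact_dual he (P.exact n).linearMap_comp_eq_zero
        (P.exact_dual n) }
  let j : G →ₗ[A] P.X 0 := (LinearMap.ker (P.d 0)).subtype ∘ₗ i.toLinearMap
  have hj : Function.Injective j := Subtype.val_injective.comp i.injective
  have hjd : Function.Exact j (P.d 0) := by
    rw [LinearMap.exact_iff, LinearMap.range_comp, LinearEquiv.range, Submodule.map_top,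
      Submodule.range_subtype]
  have hker : LinearMap.range (externalRTensor (k := k) B (Submodule.span B {e}) j) =
      LinearMap.ker (C.d 0) := (LinearMap.exact_iff.1 (externalRTensor_exact hjd)).symm
  exact ⟨C, ⟨(LinearEquiv.ofInjective _ (externalRTensor_injective hj)).trans
    (LinearEquiv.ofEq _ _ hker)⟩⟩

/-- If `e` is an idempotent of `B` with `e B e = k e`, tensoring with `B e` preserves
indecomposability. -/
theorem IsIndecomposableModule.externalTensor {k A B : Type*} [Field k] [Ring A] [Algebra k A]
    [Ring B] [Algebra k B] {G : Type*} [AddCommGroup G] [Module A G] [Module k G]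
    [IsScalarTower k A G] (hG : IsIndecomposableModule A G) {e : B} (he : IsIdempotentElem e)
    (he0 : e ≠ 0) (hcorner : ∀ b : B, ∃ c : k, e * b * e = c • e) :
    IsIndecomposableModule (A ⊗[k] B) (G ⊗[k] Submodule.span B {e}) := by
  -- Over a field some functional `f` has `f e ≠ 0`; applying it to the second factor sends `g ⊗ e`
  -- to `f e • g`.
  have hinj : Function.Injective fun g : G => g ⊗ₜ[k] spanGenerator e := by
    have h0 : spanGenerator e ≠ 0 := fun h => he0 (congrArg Subtype.val h)
    obtain ⟨f, hf⟩ := Module.Projective.exists_dual_ne_zero k h0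
    intro g g' h
    have := congrArg (TensorProduct.rid k G ∘ f.lTensor G) h
    simpa [hf] using this
  -- This is `e B e = k e` in use: the scalar of `e b e` moves across the tensor product.
  have hcoef (t : G ⊗[k] Submodule.span B {e}) :
      ∃ g : G, ((1 : A) ⊗ₜ[k] e) • t = g ⊗ₜ[k] spanGenerator e := by
    induction t with
    | zero => exact ⟨0, by rw [smul_zero, TensorProduct.zero_tmul]⟩
    | add t t' h h' =>
      obtain ⟨g, h⟩ := h
      obtain ⟨g', h'⟩ := h'
      exact ⟨g + g', by rw [smul_add, h, h', TensorProduct.add_tmul]⟩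
    | tmul m n =>
      obtain ⟨n, hn⟩ := n
      obtain ⟨b, rfl⟩ := Submodule.mem_span_singleton.1 hn
      obtain ⟨c, hc⟩ := hcorner b
      refine ⟨c • m, ?_⟩
      rw [externalTensor_smul_tmul, one_smul, TensorProduct.smul_tmul]
      congr 1
      refine Subtype.ext ?_
      change e * (b * e) = c • e
      rw [← mul_assoc, hc]
  have := hG.1
  refine ⟨hinj.nontrivial, fun N N' hN => ?_⟩
  let comap (S : Submodule (A ⊗[k] B) (G ⊗[k] Submodule.span B {e})) : Submodule A G :=
    { carrier := {g | g ⊗ₜ[k] spanGenerator e ∈ S}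
      zero_mem' := by
        rw [Set.mem_ofPred_eq, TensorProduct.zero_tmul]
        exact zero_mem _
      add_mem' := fun h h' => by
        rw [Set.mem_ofPred_eq, TensorProduct.add_tmul]
        exact add_mem h h'
      smul_mem' := fun a g h => by
        have := S.smul_mem (a ⊗ₜ[k] (1 : B)) h
        rwa [externalTensor_smul_tmul, one_smul] at this }
  have hcompl : IsCompl (comap N) (comap N') := by
    constructor
    · refine Submodule.disjoint_def.2 fun g hg hg' => hinj ?_
      change g ⊗ₜ[k] spanGenerator e = 0 ⊗ₜ[k] spanGenerator e
      rw [TensorProduct.zero_tmul]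
      exact Submodule.disjoint_def.1 hN.disjoint _ hg hg'
    -- Split `g ⊗ e` along `N ⊔ N'` and multiply by `1 ⊗ e`: the components stay in `N` and `N'`,
    -- take the form `gᵢ ⊗ e`, and still sum to `g ⊗ e`.
    · refine codisjoint_iff.2 (eq_top_iff.2 fun g _ => ?_)
      have hg : g ⊗ₜ[k] spanGenerator e ∈ N ⊔ N' := hN.sup_eq_top ▸ Submodule.mem_top
      obtain ⟨t, ht, t', ht', htt⟩ := Submodule.mem_sup.1 hg
      obtain ⟨g₁, h₁⟩ := hcoef t
      obtain ⟨g₂, h₂⟩ := hcoef t'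
      refine Submodule.mem_sup.2 ⟨g₁, ?_, g₂, ?_, hinj ?_⟩
      · change g₁ ⊗ₜ[k] spanGenerator e ∈ N
        exact h₁ ▸ N.smul_mem _ ht
      · change g₂ ⊗ₜ[k] spanGenerator e ∈ N'
        exact h₂ ▸ N'.smul_mem _ ht'
      · change (g₁ + g₂) ⊗ₜ[k] spanGenerator e = g ⊗ₜ[k] spanGenerator e
        rw [TensorProduct.add_tmul, ← h₁, ← h₂, ← smul_add, htt,
          one_tmul_smul_tmul_spanGenerator he]
  have eq_top {S : Submodule (A ⊗[k] B) (G ⊗[k] Submodule.span B {e})} (h : comap S = ⊤) :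
      S = ⊤ := externalTensor_eq_top he fun m => (h ▸ Submodule.mem_top : m ∈ comap S)
  rcases hG.2 _ _ hcompl with h | h
  · rw [h] at hcompl
    have := eq_top (eq_top_of_bot_isCompl hcompl)
    exact Or.inl (eq_bot_of_isCompl_top (this ▸ hN))
  · rw [h] at hcompl
    have := eq_top (eq_top_of_isCompl_bot hcompl)
    exact Or.inr (eq_bot_of_top_isCompl (this ▸ hN))

/-! ### The vertex idempotents of the bound quiver algebra -/

namespace PathAlgebra

variable (k : Type*) [Field k] {V : Type*} [Quiver V]

/-- The coefficient of the path of length zero at `v`. -/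
noncomputable def vertexCoeff (v : V) : PathAlgebra k V →ₗ[k] k :=
  (pathBasis k).coord (QuiverPath.nil v)

theorem vertexCoeff_vertex (v : V) : vertexCoeff k v (vertex k v) = 1 := by
  rw [vertexCoeff, vertex, ← pathBasis_apply, Module.Basis.coord_apply, Module.Basis.repr_self,
    Finsupp.single_eq_same]

variable {k} in
theorem vertexCoeff_ofPath_of_ne {v : V} {p : QuiverPath V} (h : p ≠ QuiverPath.nil v) :
    vertexCoeff k v (ofPath k p) = 0 := by
  rw [vertexCoeff, ← pathBasis_apply, Module.Basis.coord_apply, Module.Basis.repr_self,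
    Finsupp.single_eq_of_ne h.symm]

theorem vertex_mul_vertex (v : V) : vertex k v * vertex k v = vertex k v :=
  ofPath_mul_ofPath_comp k Quiver.Path.nil Quiver.Path.nil

/-- A composite of paths has length zero only if both factors do, so the coefficient at `e_v` of a
product receives only the contribution `e_v * e_v`. -/
theorem vertexCoeff_mul (v : V) (a b : PathAlgebra k V) :
    vertexCoeff k v (a * b) = vertexCoeff k v a * vertexCoeff k v b := by
  induction a using induction_on with
  | zero => simp only [zero_mul, map_zero]
  | add a a' h h' => simp only [add_mul, map_add, h, h']
  | smul r a h => simp only [smul_mul_aux, map_smul, smul_eq_mul, h, mul_assoc]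
  | path p =>
    induction b using induction_on with
    | zero => simp only [mul_zero, map_zero]
    | add b b' h h' => simp only [mul_add, map_add, h, h']
    | smul r b h => simp only [mul_smul_aux, map_smul, smul_eq_mul, h, mul_left_comm]
    | path q =>
      by_cases hpq : p = QuiverPath.nil v ∧ q = QuiverPath.nil v
      · obtain ⟨rfl, rfl⟩ := hpq
        change vertexCoeff k v (vertex k v * vertex k v) =
          vertexCoeff k v (vertex k v) * vertexCoeff k v (vertex k v)
        rw [vertex_mul_vertex, vertexCoeff_vertex, one_mul]
      · have hright : vertexCoeff k v (ofPath k p) * vertexCoeff k v (ofPath k q) = 0 := by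
          rcases not_and_or.1 hpq with h | h
          · rw [vertexCoeff_ofPath_of_ne h, zero_mul]
          · rw [vertexCoeff_ofPath_of_ne h, mul_zero]
        rw [hright]
        obtain ⟨b, c, p⟩ := p
        obtain ⟨a, b', q⟩ := q
        by_cases hb : b' = b
        · subst hb
          rw [ofPath_mul_ofPath_comp]
          refine vertexCoeff_ofPath_of_ne fun h => hpq ?_
          cases p with
          | nil =>
            rw [Quiver.Path.comp_nil] at h
            refine ⟨?_, h⟩
            have : _ = v := congrArg QuiverPath.finish h
            subst this
            rfl
          | cons p α =>
            have := congrArg QuiverPath.length h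
            exact absurd this (Nat.succ_ne_zero _)
        · rw [ofPath_mul_ofPath_of_ne k (p := ⟨b, c, p⟩) (q := ⟨a, b', q⟩) hb, map_zero]

variable [Fintype V]

theorem vertexCoeff_one (v : V) : vertexCoeff k v 1 = 1 := by
  have h := vertexCoeff_mul k v 1 (vertex k v)
  rwa [one_mul, vertexCoeff_vertex, mul_one, eq_comm] at h

/-- Taking the coefficient of the path of length zero at `v` is a ring homomorphism. -/
noncomputable def vertexCoeffHom (v : V) : PathAlgebra k V →+* k where
  toFun := vertexCoeff k v
  map_one' := vertexCoeff_one k v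
  map_mul' := vertexCoeff_mul k v
  map_zero' := map_zero _
  map_add' := map_add _

variable {k}

/-- The ring homomorphism `vertexCoeffHom` kills every path of positive length, hence all of `I`,
but sends `e_v` to `1`. -/
theorem vertex_notMem_of_isMonomialIdeal {I : TwoSidedIdeal (PathAlgebra k V)}
    (hI : IsMonomialIdeal I) (v : V) : vertex k v ∉ I := by
  obtain ⟨ρ, hρ, rfl⟩ := hI
  have hle : TwoSidedIdeal.span (ofPath k '' ρ) ≤ TwoSidedIdeal.ker (vertexCoeffHom k v) := by
    rw [TwoSidedIdeal.span_le]
    rintro _ ⟨p, hp, rfl⟩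
    refine (TwoSidedIdeal.mem_ker (vertexCoeffHom k v)).2 (vertexCoeff_ofPath_of_ne ?_)
    rintro rfl
    exact absurd (hρ _ hp) (Nat.not_succ_le_zero 0)
  intro hv
  have : vertexCoeff k v (vertex k v) = 0 :=
    (TwoSidedIdeal.mem_ker (vertexCoeffHom k v)).1 (hle hv)
  rw [vertexCoeff_vertex] at this
  exact one_ne_zero this

/-- Multiplying by `e_v` on both sides keeps only the paths from `v` to `v`, and without oriented
cycles `e_v` is the only one. -/
theorem vertex_mul_mul_vertex {v : V} (acyclic : ∀ p : Quiver.Path v v, p = Quiver.Path.nil)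
    (a : PathAlgebra k V) : ∃ c : k, vertex k v * a * vertex k v = c • vertex k v := by
  induction a using induction_on with
  | zero => exact ⟨0, by rw [mul_zero, zero_mul, zero_smul]⟩
  | add a a' h h' =>
    obtain ⟨c, h⟩ := h
    obtain ⟨c', h'⟩ := h'
    exact ⟨c + c', by rw [mul_add, add_mul, h, h', add_smul]⟩
  | smul r a h =>
    obtain ⟨c, h⟩ := h
    exact ⟨r * c, by rw [mul_smul_aux, smul_mul_aux, h, mul_smul]⟩
  | path p =>
    obtain ⟨a, b, p⟩ := p
    by_cases hb : b = v
    · by_cases ha : v = a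
      · subst hb ha
        obtain rfl := acyclic p
        refine ⟨1, ?_⟩
        change vertex k _ * vertex k _ * vertex k _ = _
        rw [vertex_mul_vertex, vertex_mul_vertex, one_smul]
      · refine ⟨0, ?_⟩
        rw [mul_assoc, vertex, ofPath_mul_ofPath_of_ne k (p := ⟨a, b, p⟩) ha, mul_zero, zero_smul]
    · refine ⟨0, ?_⟩
      rw [vertex, ofPath_mul_ofPath_of_ne k (q := ⟨a, b, p⟩) hb, zero_mul, zero_smul]

end PathAlgebra

theorem corollary4p2 {k : Type*} [Field k]
    {A : Type*} [Ring A] [Algebra k A] [Module.Finite k A]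
    {V : Type*} [Quiver V] [Fintype V] [∀ a b : V, Finite (a ⟶ b)]
    (acyclic : ∀ (v : V) (p : Quiver.Path v v), p = Quiver.Path.nil)
    (I : TwoSidedIdeal (PathAlgebra k V)) (hI : IsMonomialIdeal I)
    {G : Type*} [AddCommGroup G] [Module A G] [Module k G] [IsScalarTower k A G]
    (hG : IsIndecomposableModule A G) (hGP : IsGorensteinProjective A G) (v : V) :
    IsIndecomposableModule (A ⊗[k] BoundQuiverAlgebra I) (G ⊗[k] vertexProjective I v) ∧
      IsGorensteinProjective (A ⊗[k] BoundQuiverAlgebra I) (G ⊗[k] vertexProjective I v) := by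
  have he : IsIdempotentElem (Ideal.Quotient.mk I.asIdeal (PathAlgebra.vertex k v)) := by
    rw [IsIdempotentElem, ← map_mul, PathAlgebra.vertex_mul_vertex]
  refine ⟨hG.externalTensor he ?_ ?_, hGP.externalTensor he⟩
  · rw [Ne, Ideal.Quotient.eq_zero_iff_mem, TwoSidedIdeal.mem_asIdeal]
    exact PathAlgebra.vertex_notMem_of_isMonomialIdeal hI v
  · intro b
    obtain ⟨a, rfl⟩ := Ideal.Quotient.mk_surjective b
    obtain ⟨c, hc⟩ := PathAlgebra.vertex_mul_mul_vertex (acyclic v) a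
    refine ⟨c, ?_⟩
    rw [← map_mul, ← map_mul, hc]
    rfl
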